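/- For $\rho,M,R\in(0,\infty)$ and a dimension $d$, let $\mathcal F(\rho,M,R)$ be the set of twice differentiable functions $f:\mathbb R^d\to\mathbb R$ such that (A1) $\|\nabla^2 f(x)-\nabla^2 f(x')\|_{\mathrm F}\le\rho\|x'-x\|_2$ for all $x,x'\in\mathbb R^d$ (Frobenius norm on the left); (A2) for every $x\in\mathbb R^d$ the minimum eigenvalue of $\nabla^2 f(x)$ is greater than $M$; (A3) the infimum of $f$ over the ball $\|x\|_2\le R$ equals the infimum of $f$ over $\mathbb R^d$. Let $x^*$ denote the global minimum point of $f$. A sampling algorithm $\mathcal A$ selects, at each time $t=1,2,\dots,T$, a point $x_t\in\mathbb R^d$ from a conditional distribution given the history $(x_\tau,y_\tau)_{\tau<t}$ (a Markov kernel), and then observes $y_t=f(x_t)+w_t$. The noises $w_1,\dots,w_T$ are standard Gaussian, each $w_t$ being independent of $(x_\tau,y_\tau)_{\tau<t}$ and $x_t$. The minimax simple regret is $$\mathfrak R(T;\rho,M,R):=\inf_{\mathcal A}\ \sup_{f\in\mathcal F(\rho,M,R)}\mathbb E\left[f(x_T)-f(x^*)\right]\in[0,\infty].$$ Theorem. There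 is a universal constant $C>0$ such that for every dimension $d$ and all constants $\rho,M,R\in(0,\infty)$, $$\liminf_{T\to\infty}\mathfrak R(T;\rho,M,R)\cdot T^{2/3}\ \ge\ C\cdot\frac{\rho^{2/3}}{M}\,d .$$ -/

import Mathlib

open MeasureTheory ProbabilityTheory Filter

noncomputable section

namespace ZerothOrder

/-- The domain `ℝ^d` with the Euclidean norm. -/
abbrev Pt (d : ℕ) : Type := EuclideanSpace ℝ (Fin d)

/-- The Hessian matrix `∇² f(x)` in the standard basis. -/
def hessian {d : ℕ} (f : Pt d → ℝ) (x : Pt d) : Matrix (Fin d) (Fin d) ℝ :=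
  Matrix.of fun i j =>
    fderiv ℝ (fderiv ℝ f) x (EuclideanSpace.single i 1) (EuclideanSpace.single j 1)

section

open scoped Matrix.Norms.Frobenius

/-- The class `F(ρ, M, R)` of objective functions. The norm of matrices is the Frobenius norm;
the infima are taken in the extended reals. -/
structure InClass {d : ℕ} (ρ M R : ℝ) (f : Pt d → ℝ) : Prop where
  /-- `f` is twice differentiable. -/
  differentiable : Differentiable ℝ f
  differentiable_fderiv : Differentiable ℝ (fderiv ℝ f)
  /-- (A1) The Hessian is `ρ`-Lipschitz in Frobenius norm. -/
  lipschitz_hessian : ∀ x x' : Pt d, ‖hessian f x - hessian f x'‖ ≤ ρ * ‖x' - x‖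
  /-- (A2) All eigenvalues of every Hessian are greater than `M`. -/
  strong_convexity : ∀ (x : Pt d) (μ : ℝ),
    Module.End.HasEigenvalue (Matrix.toLin' (hessian f x)) μ → M < μ
  /-- (A3) The infimum over the ball of radius `R` is the global infimum. -/
  inf_ball_eq : (⨅ x ∈ Metric.closedBall (0 : Pt d) R, (f x : EReal)) = ⨅ x, (f x : EReal)

end

/-- The data seen after `t` samples: the queried points and the observed values. -/
abbrev History (d t : ℕ) : Type := Fin t → Pt d × ℝ

/-- A (possibly randomized) adaptive sampling algorithm: `query t` is the conditional distribution
of the `(t+1)`-st query point given the first `t` pairs (query point, observation). -/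
structure Algorithm (d : ℕ) where
  query : (t : ℕ) → Kernel (History d t) (Pt d)
  markov : ∀ t, IsMarkovKernel (query t)

/-- Appending the query point `x` and the observation `f x + w` to a history, as a function of
`((history, x), w)`. -/
def appendRound {d : ℕ} (f : Pt d → ℝ) (t : ℕ) (p : (History d t × Pt d) × ℝ) : History d (t + 1) :=
  Fin.snoc (α := fun _ => Pt d × ℝ) p.1.1 (p.1.2, f p.1.2 + p.2)

/-- The law of the first `t` pairs (query point, observation) when the algorithm `A` interacts with
`f`. In each round the query point is drawn from `A.query` given the history, and the noise is
standard Gaussian, independent of the history and of the query point. -/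
def Algorithm.historyLaw {d : ℕ} (A : Algorithm d) (f : Pt d → ℝ) : (t : ℕ) → Measure (History d t)
  | 0 => Measure.dirac Fin.elim0
  | t + 1 =>
      (((A.historyLaw f t) ⊗ₘ (A.query t)).prod (gaussianReal 0 1)).map (appendRound f t)

/-- The law of the `T`-th query point `x_T` (for `T ≥ 1`), which is selected after `T - 1`
observations. -/
def Algorithm.pointLaw {d : ℕ} (A : Algorithm d) (f : Pt d → ℝ) (T : ℕ) : Measure (Pt d) :=
  (A.historyLaw f (T - 1)).bind (A.query (T - 1))

/-- The expected simple regret `E[f(x_T) - f(x^*)]`, where `f(x^*)` is the global minimum value.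
The integrand is nonnegative whenever `f` is bounded below; the value `∞` is allowed. -/
def Algorithm.simpleRegret {d : ℕ} (A : Algorithm d) (f : Pt d → ℝ) (T : ℕ) : ENNReal :=
  ∫⁻ x, ENNReal.ofReal (f x - ⨅ z, f z) ∂(A.pointLaw f T)

/-- The minimax simple regret under standard Gaussian noise. -/
def minimaxRegret (d : ℕ) (ρ M R : ℝ) (T : ℕ) : ENNReal :=
  ⨅ A : Algorithm d, ⨆ f : {f : Pt d → ℝ // InClass ρ M R f}, A.simpleRegret f.1 T

end ZerothOrder

end

/-! The hard instances perturb `M x²` in each coordinate by `± ρ w³ sin (x / w)`. The third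
derivative of the perturbation is at most `ρ` and its second derivative at most `ρ w < M`, so every
sign pattern gives an admissible function. The sign decides on which side of the origin a
coordinate's minimizer lies. A query on the wrong side loses at least `ρ² w⁴ / (π² M)` in that
coordinate (`sum_indicator_le_sub_iInf`).

Flipping one sign moves the objective by at most `δ = 2 ρ w³` everywhere. A χ² comparison, chained
over the rounds (`Algorithm.sq_lintegral_historyLaw_le`), shows that such a pair cannot be told
apart while `T δ² ≤ 1`. Averaging over all sign patterns (Assouad, `le_minimaxRegret`) yields regret
of order `d ρ² w⁴ / M`. Taking `T δ² = 1`, that is `w = (2ρ)^(-1/3) T^(-1/6)`, gives the rate. -/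

namespace ZerothOrder

open scoped ENNReal

/-! ### Comparison of Gaussian measures -/

/-- The Cauchy–Schwarz inequality for the Lebesgue integral of `ℝ≥0∞`-valued functions. -/
theorem sq_lintegral_mul_le {α : Type*} [MeasurableSpace α] (μ : Measure α) {f g : α → ℝ≥0∞}
    (hf : AEMeasurable f μ) (hg : AEMeasurable g μ) :
    (∫⁻ a, f a * g a ∂μ) ^ 2 ≤ (∫⁻ a, f a ^ 2 ∂μ) * ∫⁻ a, g a ^ 2 ∂μ := by
  have h := ENNReal.lintegral_mul_le_Lp_mul_Lq μ Real.HolderConjugate.two_two hf hg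
  simp only [Pi.mul_apply, ENNReal.rpow_two] at h
  calc (∫⁻ a, f a * g a ∂μ) ^ 2
      ≤ ((∫⁻ a, f a ^ 2 ∂μ) ^ (1 / 2 : ℝ) * (∫⁻ a, g a ^ 2 ∂μ) ^ (1 / 2 : ℝ)) ^ 2 := by gcongr
    _ = _ := by
      rw [mul_pow, ← ENNReal.rpow_two, ← ENNReal.rpow_two, ← ENNReal.rpow_mul, ← ENNReal.rpow_mul]
      norm_num

theorem sq_lintegral_le {α : Type*} [MeasurableSpace α] (μ : Measure α) [IsProbabilityMeasure μ]
    {f : α → ℝ≥0∞} (hf : AEMeasurable f μ) : (∫⁻ a, f a ∂μ) ^ 2 ≤ ∫⁻ a, f a ^ 2 ∂μ := by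
  simpa using sq_lintegral_mul_le μ hf (g := fun _ => 1) aemeasurable_const

/-- Completing the square: `p_a² / p_b` is `exp ((a - b)²)` times the Gaussian density centred at
`2a - b`, so its total mass can be read off. -/
theorem gaussianPDF_eq_sqrt_mul_sqrt (a b x : ℝ) :
    gaussianPDF a 1 x = ENNReal.ofReal √(gaussianPDFReal b 1 x) *
      ENNReal.ofReal √(Real.exp ((a - b) ^ 2) * gaussianPDFReal (2 * a - b) 1 x) := by
  rw [gaussianPDF, ← ENNReal.ofReal_mul (Real.sqrt_nonneg _),
    ← Real.sqrt_mul (gaussianPDFReal_nonneg _ _ _)]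
  congr 1
  rw [eq_comm, Real.sqrt_eq_iff_eq_sq
    (mul_nonneg (gaussianPDFReal_nonneg _ _ _)
      (mul_nonneg (Real.exp_pos _).le (gaussianPDFReal_nonneg _ _ _)))
    (gaussianPDFReal_nonneg _ _ _)]
  simp only [gaussianPDFReal]
  have h : Real.exp (-(x - b) ^ 2 / 2) * (Real.exp ((a - b) ^ 2) *
      Real.exp (-(x - (2 * a - b)) ^ 2 / 2)) = Real.exp (-(x - a) ^ 2 / 2) ^ 2 := by
    rw [← Real.exp_add, ← Real.exp_add, sq (Real.exp _), ← Real.exp_add]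
    congr 1
    ring
  simp only [NNReal.coe_one, mul_one] at h ⊢
  rw [mul_pow, ← h]
  ring

/-- Comparison of two unit-variance Gaussians through their `χ²`-divergence. -/
theorem sq_lintegral_gaussianReal_le (a b : ℝ) {g : ℝ → ℝ≥0∞} (hg : Measurable g) :
    (∫⁻ y, g y ∂(gaussianReal a 1)) ^ 2 ≤
      ENNReal.ofReal (Real.exp ((a - b) ^ 2)) * ∫⁻ y, g y ^ 2 ∂(gaussianReal b 1) := by
  have hm (c : ℝ) : Measurable (gaussianPDF c 1) := measurable_gaussianPDF c 1
  rw [gaussianReal_of_var_ne_zero a one_ne_zero, gaussianReal_of_var_ne_zero b one_ne_zero,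
    lintegral_withDensity_eq_lintegral_mul _ (hm a) hg,
    lintegral_withDensity_eq_lintegral_mul _ (hm b) (hg.pow_const 2)]
  have hr (c : ℝ) : Measurable (gaussianPDFReal c 1) := measurable_gaussianPDFReal c 1
  have hu : Measurable fun y => ENNReal.ofReal √(gaussianPDFReal b 1 y) :=
    (hr b).sqrt.ennreal_ofReal
  have hv : Measurable fun y =>
      ENNReal.ofReal √(Real.exp ((a - b) ^ 2) * gaussianPDFReal (2 * a - b) 1 y) :=
    ((hr _).const_mul _).sqrt.ennreal_ofReal
  have hsq {z : ℝ} (hz : 0 ≤ z) : ENNReal.ofReal √z ^ 2 = ENNReal.ofReal z := by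
    rw [← ENNReal.ofReal_pow (Real.sqrt_nonneg _), Real.sq_sqrt hz]
  calc (∫⁻ y, (gaussianPDF a 1 * g) y) ^ 2
      = (∫⁻ y, ENNReal.ofReal √(Real.exp ((a - b) ^ 2) * gaussianPDFReal (2 * a - b) 1 y) *
          (ENNReal.ofReal √(gaussianPDFReal b 1 y) * g y)) ^ 2 := by
        congr 1
        refine lintegral_congr fun y => ?_
        rw [Pi.mul_apply, gaussianPDF_eq_sqrt_mul_sqrt a b]
        ring
    _ ≤ _ := sq_lintegral_mul_le _ hv.aemeasurable (hu.mul hg).aemeasurable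
    _ = _ := by
        congr 1
        · simp_rw [hsq (mul_nonneg (Real.exp_pos _).le (gaussianPDFReal_nonneg _ _ _)),
            ENNReal.ofReal_mul (Real.exp_pos _).le]
          rw [lintegral_const_mul _ (hr _).ennreal_ofReal]
          have := lintegral_gaussianPDF_eq_one (2 * a - b) (v := 1) one_ne_zero
          simp only [gaussianPDF] at this
          rw [this, mul_one]
        · refine lintegral_congr fun y => ?_
          rw [mul_pow, hsq (gaussianPDFReal_nonneg _ _ _)]
          rfl

theorem sq_lintegral_add_gaussianReal_le (a b : ℝ) {g : ℝ → ℝ≥0∞} (hg : Measurable g) :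
    (∫⁻ w, g (a + w) ∂(gaussianReal 0 1)) ^ 2 ≤
      ENNReal.ofReal (Real.exp ((a - b) ^ 2)) * ∫⁻ w, g (b + w) ^ 2 ∂(gaussianReal 0 1) := by
  have key (c : ℝ) {k : ℝ → ℝ≥0∞} (hk : Measurable k) :
      ∫⁻ w, k (c + w) ∂(gaussianReal 0 1) = ∫⁻ y, k y ∂(gaussianReal c 1) := by
    rw [← zero_add c, ← gaussianReal_map_const_add c, lintegral_map hk (by fun_prop), zero_add]
  rw [key a hg, key b (hg.pow_const 2)]
  exact sq_lintegral_gaussianReal_le a b hg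

/-! ### Indistinguishability of nearby objectives -/

section Algorithm

variable {d : ℕ}

theorem measurable_appendRound {f : Pt d → ℝ} (hf : Measurable f) (t : ℕ) :
    Measurable (appendRound f t) := by
  rw [measurable_pi_iff]
  intro i
  refine Fin.lastCases ?_ (fun j => ?_) i
  · simp only [appendRound, Fin.snoc_last]
    fun_prop
  · simp only [appendRound, Fin.snoc_castSucc]
    fun_prop

theorem Algorithm.isProbabilityMeasure_historyLaw (A : Algorithm d) {f : Pt d → ℝ}
    (hf : Measurable f) (t : ℕ) : IsProbabilityMeasure (A.historyLaw f t) := by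
  induction t with
  | zero => exact Measure.dirac.isProbabilityMeasure
  | succ t ih =>
    have := A.markov t
    exact Measure.isProbabilityMeasure_map (measurable_appendRound hf t).aemeasurable

theorem Algorithm.lintegral_historyLaw_succ (A : Algorithm d) {f : Pt d → ℝ}
    (hf : Measurable f) (t : ℕ) {g : History d (t + 1) → ℝ≥0∞} (hg : Measurable g) :
    ∫⁻ h, g h ∂(A.historyLaw f (t + 1)) =
      ∫⁻ h, ∫⁻ x, ∫⁻ w, g (appendRound f t ((h, x), w)) ∂(gaussianReal 0 1) ∂(A.query t h)
        ∂(A.historyLaw f t) := by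
  have := A.markov t
  have := A.isProbabilityMeasure_historyLaw hf t
  have hm : Measurable fun p => g (appendRound f t p) := hg.comp (measurable_appendRound hf t)
  rw [historyLaw, lintegral_map hg (measurable_appendRound hf t), lintegral_prod _ hm.aemeasurable,
    Measure.lintegral_compProd hm.lintegral_prod_right']

/-- Two objectives that differ by at most `δ` generate histories whose laws are comparable. -/
theorem Algorithm.sq_lintegral_historyLaw_le (A : Algorithm d) {f f' : Pt d → ℝ}
    (hf : Measurable f) (hf' : Measurable f') {δ : ℝ} (hδ : ∀ x, |f x - f' x| ≤ δ) (t : ℕ)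
    {g : History d t → ℝ≥0∞} (hg : Measurable g) :
    (∫⁻ h, g h ∂(A.historyLaw f t)) ^ 2 ≤
      ENNReal.ofReal (Real.exp (δ ^ 2)) ^ t * ∫⁻ h, g h ^ 2 ∂(A.historyLaw f' t) := by
  induction t with
  | zero => simp [historyLaw, lintegral_dirac' _ hg, lintegral_dirac' _ (hg.pow_const 2)]
  | succ t ih =>
    have := A.markov t
    have hm : Measurable fun p => g (appendRound f t p) := hg.comp (measurable_appendRound hf t)
    have hm' : Measurable fun p => g (appendRound f' t p) ^ 2 :=
      (hg.comp (measurable_appendRound hf' t)).pow_const 2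
    rw [A.lintegral_historyLaw_succ hf t hg, A.lintegral_historyLaw_succ hf' t (hg.pow_const 2)]
    set K := ENNReal.ofReal (Real.exp (δ ^ 2)) with hK
    have hG : Measurable fun h => ∫⁻ x, ∫⁻ w, g (appendRound f t ((h, x), w))
        ∂(gaussianReal 0 1) ∂(A.query t h) :=
      Measurable.lintegral_kernel_prod_right hm.lintegral_prod_right'
    have hG' : Measurable fun h => ∫⁻ x, ∫⁻ w, g (appendRound f' t ((h, x), w)) ^ 2
        ∂(gaussianReal 0 1) ∂(A.query t h) :=
      Measurable.lintegral_kernel_prod_right hm'.lintegral_prod_right'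
    -- The induction hypothesis is applied to the conditional expectation of `g` given the first `t`
    -- rounds. Its square is bounded by Jensen over the query, whose kernel does not depend on the
    -- objective, then by the Gaussian comparison over the noise.
    refine (ih hG).trans ?_
    rw [pow_succ, mul_assoc]
    gcongr
    rw [← lintegral_const_mul _ hG']
    refine lintegral_mono fun h => ?_
    have hx : Measurable fun x => ∫⁻ w, g (appendRound f t ((h, x), w)) ∂(gaussianReal 0 1) :=
      hm.lintegral_prod_right'.comp measurable_prodMk_left
    have hx' : Measurable fun x =>
        ∫⁻ w, g (appendRound f' t ((h, x), w)) ^ 2 ∂(gaussianReal 0 1) :=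
      hm'.lintegral_prod_right'.comp measurable_prodMk_left
    refine (sq_lintegral_le _ hx.aemeasurable).trans ?_
    rw [← lintegral_const_mul _ hx']
    refine lintegral_mono fun x => ?_
    have hy : Measurable fun y => g (Fin.snoc (α := fun _ => Pt d × ℝ) h (x, y)) := by
      have := hg.comp ((measurable_appendRound (f := fun _ : Pt d => (0 : ℝ))
        measurable_const t).comp (measurable_prodMk_left (x := (h, x))))
      simpa [appendRound, Function.comp_def] using this
    refine (sq_lintegral_add_gaussianReal_le (f x) (f' x) hy).trans ?_
    refine mul_le_mul_left (ENNReal.ofReal_le_ofReal (Real.exp_le_exp.2 ?_)) _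
    exact sq_le_sq' (abs_le.1 (hδ x)).1 (abs_le.1 (hδ x)).2

theorem Algorithm.isProbabilityMeasure_pointLaw (A : Algorithm d) {f : Pt d → ℝ}
    (hf : Measurable f) (T : ℕ) : IsProbabilityMeasure (A.pointLaw f T) := by
  have := A.markov (T - 1)
  have := A.isProbabilityMeasure_historyLaw hf (T - 1)
  unfold pointLaw
  infer_instance

/-- The history comparison is applied to `g`, the conditional probability of querying `S`, for which
`g² ≤ g`. Only `T - 1` observations precede the last query, so the factor is at most `e`. -/
theorem Algorithm.sq_pointLaw_le (A : Algorithm d) {f f' : Pt d → ℝ}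
    (hf : Measurable f) (hf' : Measurable f') {δ : ℝ} (hδ : ∀ x, |f x - f' x| ≤ δ) {T : ℕ}
    (hT : T * δ ^ 2 ≤ 1) {S : Set (Pt d)} (hS : MeasurableSet S) :
    A.pointLaw f T S ^ 2 ≤ ENNReal.ofReal (Real.exp 1) * A.pointLaw f' T S := by
  have := A.markov (T - 1)
  have hq : Measurable fun h => A.query (T - 1) h S := Kernel.measurable_coe _ hS
  have hk (k : Pt d → ℝ) : A.pointLaw k T S = ∫⁻ h, A.query (T - 1) h S ∂A.historyLaw k (T - 1) :=
    Measure.bind_apply hS (Kernel.aemeasurable _)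
  rw [hk, hk]
  refine (A.sq_lintegral_historyLaw_le hf hf' hδ _ hq).trans ?_
  gcongr with h
  · rw [← ENNReal.ofReal_pow (Real.exp_pos _).le, ← Real.exp_nat_mul]
    refine ENNReal.ofReal_le_ofReal (Real.exp_le_exp.2 (le_trans ?_ hT))
    gcongr
    omega
  · exact pow_le_of_le_one zero_le prob_le_one two_ne_zero

/-- No test based on the last query distinguishes two objectives that are `T^{-1/2}`-close. -/
theorem Algorithm.le_pointLaw_add_pointLaw_compl (A : Algorithm d) {f f' : Pt d → ℝ}
    (hf : Measurable f) (hf' : Measurable f') {δ : ℝ} (hδ : ∀ x, |f x - f' x| ≤ δ) {T : ℕ}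
    (hT : T * δ ^ 2 ≤ 1) {S : Set (Pt d)} (hS : MeasurableSet S) :
    ENNReal.ofReal (1 / (4 * Real.exp 1)) ≤ A.pointLaw f' T S + A.pointLaw f T Sᶜ := by
  have := A.isProbabilityMeasure_pointLaw hf T
  have := A.isProbabilityMeasure_pointLaw hf' T
  have h := A.sq_pointLaw_le hf hf' hδ hT hS
  rw [← ofReal_measureReal, ← ofReal_measureReal, ← ENNReal.ofReal_pow measureReal_nonneg,
    ← ENNReal.ofReal_mul (Real.exp_pos _).le, ENNReal.ofReal_le_ofReal_iff (by positivity)] at h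
  rw [← ofReal_measureReal, ← ofReal_measureReal,
    ← ENNReal.ofReal_add measureReal_nonneg measureReal_nonneg]
  apply ENNReal.ofReal_le_ofReal
  rw [probReal_compl_eq_one_sub hS, div_le_iff₀ (by positivity)]
  have h0 : 0 ≤ (A.pointLaw f' T).real S := measureReal_nonneg
  have h1 : (A.pointLaw f T).real S ≤ 1 := measureReal_le_one
  have he : 1 ≤ Real.exp 1 := Real.one_le_exp zero_le_one
  -- With `p`, `q` the probabilities of `S` under `f`, `f'`, the bounds `p² ≤ e q` and `e ≥ 1` give
  -- `4e (q + 1 - p) ≥ 4p² + 4(1 - p) = (2p - 1)² + 3`.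
  nlinarith [sq_nonneg ((A.pointLaw f T).real S - 1 / 2),
    sq_nonneg ((A.pointLaw f T).real S - 2)]

end Algorithm

/-! ### Separable functions -/

/-- The function `x ↦ ∑ i, ψ i (x i)`. -/
def separable {d : ℕ} (ψ : Fin d → ℝ → ℝ) (x : Pt d) : ℝ := ∑ i, ψ i (x i)

section Separable

variable {d : ℕ} {ψ ψ' ψ'' : Fin d → ℝ → ℝ}

theorem hasFDerivAt_separable (h : ∀ i t, HasDerivAt (ψ i) (ψ' i t) t) (x : Pt d) :
    HasFDerivAt (separable ψ) (∑ i, ψ' i (x i) • (EuclideanSpace.proj i : Pt d →L[ℝ] ℝ)) x :=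
  HasFDerivAt.fun_sum fun i _ =>
    (h i (x i)).comp_hasFDerivAt x (EuclideanSpace.proj i : Pt d →L[ℝ] ℝ).hasFDerivAt

theorem fderiv_separable (h : ∀ i t, HasDerivAt (ψ i) (ψ' i t) t) :
    fderiv ℝ (separable ψ) =
      fun x => ∑ i, ψ' i (x i) • (EuclideanSpace.proj i : Pt d →L[ℝ] ℝ) :=
  funext fun x => (hasFDerivAt_separable h x).fderiv

theorem hasFDerivAt_fderiv_separable (h : ∀ i t, HasDerivAt (ψ i) (ψ' i t) t)
    (h' : ∀ i t, HasDerivAt (ψ' i) (ψ'' i t) t) (x : Pt d) :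
    HasFDerivAt (fderiv ℝ (separable ψ))
      (∑ i, (ψ'' i (x i) • (EuclideanSpace.proj i : Pt d →L[ℝ] ℝ)).smulRight
        (EuclideanSpace.proj i : Pt d →L[ℝ] ℝ)) x := by
  rw [fderiv_separable h]
  refine HasFDerivAt.fun_sum fun i _ => ?_
  have := (h' i (x i)).comp_hasFDerivAt x (EuclideanSpace.proj i : Pt d →L[ℝ] ℝ).hasFDerivAt
  exact this.smul_const (EuclideanSpace.proj i : Pt d →L[ℝ] ℝ)

theorem hessian_separable (h : ∀ i t, HasDerivAt (ψ i) (ψ' i t) t)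
    (h' : ∀ i t, HasDerivAt (ψ' i) (ψ'' i t) t) (x : Pt d) :
    hessian (separable ψ) x = Matrix.diagonal fun i => ψ'' i (x i) := by
  ext i j
  rw [hessian, Matrix.of_apply, (hasFDerivAt_fderiv_separable h h' x).fderiv, Matrix.diagonal_apply]
  simp only [sum_apply, ContinuousLinearMap.smulRight_apply,
    smul_apply, EuclideanSpace.coe_proj, PiLp.single_apply, smul_eq_mul]
  rw [Finset.sum_eq_single i (fun k _ hk => by simp [hk]) (by simp)]
  simp

open scoped Matrix.Norms.Frobenius in
-- The Hessian is diagonal, so its Frobenius norm is the Euclidean norm of the diagonal and the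
-- coordinatewise Lipschitz constant carries over without a dimension factor.
theorem inClass_separable {ρ M R r : ℝ} (h : ∀ i t, HasDerivAt (ψ i) (ψ' i t) t)
    (h' : ∀ i t, HasDerivAt (ψ' i) (ψ'' i t) t) (hρ : 0 ≤ ρ)
    (hlip : ∀ i s t, |ψ'' i s - ψ'' i t| ≤ ρ * |s - t|) (hM : ∀ i t, M < ψ'' i t)
    (hmin : ∀ i, ∃ z, |z| ≤ r ∧ ∀ t, ψ i z ≤ ψ i t) (hr : 0 ≤ r) (hrR : √d * r ≤ R) :
    InClass ρ M R (separable ψ) where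
  differentiable x := (hasFDerivAt_separable h x).differentiableAt
  differentiable_fderiv x := (hasFDerivAt_fderiv_separable h h' x).differentiableAt
  lipschitz_hessian x x' := by
    rw [hessian_separable h h', hessian_separable h h', Matrix.diagonal_sub,
      Matrix.frobenius_norm_diagonal, norm_sub_rev, EuclideanSpace.norm_eq, EuclideanSpace.norm_eq,
      ← Real.sqrt_sq hρ, ← Real.sqrt_mul (sq_nonneg ρ), Finset.mul_sum]
    refine Real.sqrt_le_sqrt (Finset.sum_le_sum fun i _ => ?_)
    rw [← mul_pow]
    exact pow_le_pow_left₀ (norm_nonneg _) (hlip i (x i) (x' i)) 2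
  strong_convexity x μ hμ := by
    rw [hessian_separable h h', hasEigenvalue_toLin'_diagonal_iff] at hμ
    obtain ⟨i, rfl⟩ := hμ
    exact hM i _
  inf_ball_eq := by
    choose z hz hzmin using hmin
    refine le_antisymm (le_iInf fun x => ?_) (le_iInf₂ fun x _ => iInf_le _ x)
    refine (iInf₂_le (WithLp.toLp 2 z) ?_).trans ?_
    · rw [mem_closedBall_zero_iff, EuclideanSpace.norm_eq]
      refine le_trans ?_ hrR
      rw [← Real.sqrt_sq hr, ← Real.sqrt_mul (Nat.cast_nonneg d)]
      apply Real.sqrt_le_sqrt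
      calc ∑ i, ‖z i‖ ^ 2 ≤ ∑ _i : Fin d, r ^ 2 :=
            Finset.sum_le_sum fun i _ => pow_le_pow_left₀ (norm_nonneg _) (hz i) 2
        _ = d * r ^ 2 := by simp
    · exact EReal.coe_le_coe_iff.2 (Finset.sum_le_sum fun i _ => hzmin i _)

end Separable

/-! ### The one-dimensional hard instance -/

/-- The strongly convex function `M x² + σ ρ w³ sin (x / w)` on the line. -/
noncomputable def sineBowl (ρ M w : ℝ) (σ : ℤˣ) (x : ℝ) : ℝ :=
  M * x ^ 2 + (σ : ℤ) * (ρ * w ^ 3 * Real.sin (x / w))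

section SineBowl

variable {ρ M w : ℝ}

theorem abs_sign (σ : ℤˣ) : |((σ : ℤ) : ℝ)| = 1 := by
  rcases Int.units_eq_one_or σ with rfl | rfl <;> simp

theorem hasDerivAt_sineBowl (σ : ℤˣ) (x : ℝ) :
    HasDerivAt (sineBowl ρ M w σ)
      (2 * M * x + (σ : ℤ) * (ρ * w ^ 2 * Real.cos (x / w))) x := by
  have := ((hasDerivAt_pow 2 x).const_mul M).add
    ((((hasDerivAt_id x).div_const w).sin.const_mul (ρ * w ^ 3)).const_mul (((σ : ℤ) : ℝ)))
  refine this.congr_deriv ?_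
  simp only [id]
  field_simp
  norm_num
  ring

theorem hasDerivAt_deriv_sineBowl (σ : ℤˣ) (x : ℝ) :
    HasDerivAt (fun x => 2 * M * x + (σ : ℤ) * (ρ * w ^ 2 * Real.cos (x / w)))
      (2 * M - (σ : ℤ) * (ρ * w * Real.sin (x / w))) x := by
  have := ((hasDerivAt_id x).const_mul (2 * M)).add
    ((((hasDerivAt_id x).div_const w).cos.const_mul (ρ * w ^ 2)).const_mul (((σ : ℤ) : ℝ)))
  refine this.congr_deriv ?_
  simp only [id]
  field_simp
  ring

theorem sineBowl_neg (σ : ℤˣ) (x : ℝ) : sineBowl ρ M w (-σ) x = sineBowl ρ M w σ (-x) := by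
  simp only [sineBowl, neg_div, Real.sin_neg]
  push_cast
  ring

theorem abs_sineBowl_sub_neg_le (hρ : 0 ≤ ρ) (hw : 0 ≤ w) (σ : ℤˣ) (x : ℝ) :
    |sineBowl ρ M w σ x - sineBowl ρ M w (-σ) x| ≤ 2 * (ρ * w ^ 3) := by
  have h : sineBowl ρ M w σ x - sineBowl ρ M w (-σ) x =
      (σ : ℤ) * (2 * (ρ * w ^ 3) * Real.sin (x / w)) := by
    simp only [sineBowl]
    push_cast
    ring
  rw [h, abs_mul, abs_sign, one_mul, abs_mul, abs_of_nonneg (by positivity)]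
  exact mul_le_of_le_one_right (by positivity) (Real.abs_sin_le_one _)

theorem sineBowl_nonneg_of_le_abs (hρ : 0 ≤ ρ) (hw : 0 < w) (hM : ρ * w ≤ M) (σ : ℤˣ)
    {x : ℝ} (hx : w ≤ |x|) : 0 ≤ sineBowl ρ M w σ x := by
  have h1 : |((σ : ℤ) : ℝ) * (ρ * w ^ 3 * Real.sin (x / w))| ≤ ρ * w ^ 3 := by
    rw [abs_mul, abs_sign, one_mul, abs_mul, abs_of_nonneg (by positivity)]
    exact mul_le_of_le_one_right (by positivity) (Real.abs_sin_le_one _)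
  have h2 : w ^ 2 ≤ x ^ 2 := by
    rw [← sq_abs x]
    exact pow_le_pow_left₀ hw.le hx 2
  have h3 : ρ * w * w ^ 2 ≤ M * x ^ 2 :=
    mul_le_mul hM h2 (by positivity) (le_trans (by positivity) hM)
  have := (abs_le.1 h1).1
  rw [sineBowl]
  linarith

/-- For `|x| ≤ w` the argument `x / w` stays within `[-π, π]`, so the perturbation is nonnegative on
this side; further out the quadratic dominates. -/
theorem sineBowl_nonneg (hρ : 0 ≤ ρ) (hw : 0 < w) (hM : ρ * w ≤ M) (σ : ℤˣ) {x : ℝ}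
    (hx : 0 ≤ ((σ : ℤ) : ℝ) * x) : 0 ≤ sineBowl ρ M w σ x := by
  have hM0 : 0 ≤ M := le_trans (by positivity) hM
  have key {y : ℝ} (hy : 0 ≤ y) : 0 ≤ sineBowl ρ M w 1 y := by
    rcases le_total w y with h | h
    · exact sineBowl_nonneg_of_le_abs hρ hw hM 1 (h.trans (le_abs_self y))
    · have : 0 ≤ Real.sin (y / w) := Real.sin_nonneg_of_nonneg_of_le_pi (by positivity)
        (((div_le_one hw).2 h).trans (by linarith [Real.pi_gt_three]))
      simp only [sineBowl, Units.val_one, Int.cast_one, one_mul]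
      positivity
  rcases Int.units_eq_one_or σ with rfl | rfl
  · exact key (by simpa using hx)
  · rw [sineBowl_neg]
    exact key (by simpa using hx)

theorem sineBowl_apply_le (hρ : 0 ≤ ρ) (hw : 0 < w) (hM0 : 0 < M) (hM : ρ * w ≤ M) (σ : ℤˣ) :
    ∃ x, sineBowl ρ M w σ x ≤ -(ρ ^ 2 * w ^ 4 / (Real.pi ^ 2 * M)) := by
  -- The witness minimizes `M x² - (2/π) ρ w² x`, the upper bound obtained from Jordan's inequality
  -- `sin u ≥ 2u/π`.
  have key : sineBowl ρ M w (-1) (ρ * w ^ 2 / (Real.pi * M)) ≤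
      -(ρ ^ 2 * w ^ 4 / (Real.pi ^ 2 * M)) := by
    have hpi := Real.pi_gt_three
    have h0 : ρ * w ^ 2 / (Real.pi * M) / w = ρ * w / (Real.pi * M) := by field_simp
    have h1 := Real.mul_le_sin (x := ρ * w / (Real.pi * M)) (by positivity) (by
      rw [div_le_iff₀ (by positivity)]
      have : 1 ≤ Real.pi / 2 * Real.pi := by nlinarith
      nlinarith)
    have h2 := mul_le_mul_of_nonneg_left h1 (show 0 ≤ ρ * w ^ 3 by positivity)
    have h3 : ρ * w ^ 3 * (2 / Real.pi * (ρ * w / (Real.pi * M))) =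
        2 * (ρ ^ 2 * w ^ 4 / (Real.pi ^ 2 * M)) := by field_simp
    have h4 : M * (ρ * w ^ 2 / (Real.pi * M)) ^ 2 = ρ ^ 2 * w ^ 4 / (Real.pi ^ 2 * M) := by
      field_simp
    rw [h3] at h2
    rw [sineBowl, h0, h4]
    push_cast
    linarith
  rcases Int.units_eq_one_or σ with rfl | rfl
  · refine ⟨-(ρ * w ^ 2 / (Real.pi * M)), ?_⟩
    rw [← sineBowl_neg]
    exact key
  · exact ⟨_, key⟩

theorem exists_minimizer_sineBowl (hρ : 0 ≤ ρ) (hw : 0 < w) (hM : ρ * w ≤ M) (σ : ℤˣ) :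
    ∃ z, |z| ≤ w ∧ ∀ x, sineBowl ρ M w σ z ≤ sineBowl ρ M w σ x := by
  have hc : Continuous (sineBowl ρ M w σ) :=
    continuous_iff_continuousAt.2 fun x => (hasDerivAt_sineBowl σ x).continuousAt
  obtain ⟨z, hz, hmin⟩ := (isCompact_Icc (a := -w) (b := w)).exists_isMinOn
    ⟨0, by simp [hw.le]⟩ hc.continuousOn
  refine ⟨z, abs_le.2 hz, fun x => ?_⟩
  rcases le_total |x| w with h | h
  · exact hmin (abs_le.1 h)
  · calc sineBowl ρ M w σ z ≤ sineBowl ρ M w σ 0 := hmin (by simp [hw.le])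
      _ = 0 := by simp [sineBowl]
      _ ≤ _ := sineBowl_nonneg_of_le_abs hρ hw hM σ h

theorem inClass_separable_sineBowl {d : ℕ} {R : ℝ} (hρ : 0 ≤ ρ) (hw : 0 < w) (hM : ρ * w < M)
    (hR : √d * w ≤ R) (s : Fin d → ℤˣ) :
    InClass ρ M R (separable fun i => sineBowl ρ M w (s i)) := by
  refine inClass_separable (fun i => hasDerivAt_sineBowl (s i))
    (fun i => hasDerivAt_deriv_sineBowl (s i)) hρ (fun i x y => ?_) (fun i x => ?_)
    (fun i => exists_minimizer_sineBowl hρ hw hM.le (s i)) hw.le hR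
  · have h1 : 2 * M - ((s i : ℤ) : ℝ) * (ρ * w * Real.sin (x / w)) -
        (2 * M - ((s i : ℤ) : ℝ) * (ρ * w * Real.sin (y / w))) =
        (s i : ℤ) * (ρ * w * (Real.sin (y / w) - Real.sin (x / w))) := by ring
    have h2 := Real.abs_sin_sub_sin_le (y / w) (x / w)
    rw [← sub_div, abs_div, abs_of_pos hw] at h2
    rw [h1, abs_mul, abs_sign, one_mul, abs_mul, abs_of_nonneg (by positivity)]
    calc ρ * w * |Real.sin (y / w) - Real.sin (x / w)| ≤ ρ * w * (|y - x| / w) := by gcongr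
      _ = ρ * |x - y| := by
        rw [abs_sub_comm]
        field_simp
  · have h : |((s i : ℤ) : ℝ) * (ρ * w * Real.sin (x / w))| ≤ ρ * w := by
      rw [abs_mul, abs_sign, one_mul, abs_mul, abs_of_nonneg (by positivity)]
      exact mul_le_of_le_one_right (by positivity) (Real.abs_sin_le_one _)
    linarith [(abs_le.1 h).2]

/-- Every coordinate of the query on the wrong side of the origin costs
`ρ² w⁴ / (π² M)` in regret. -/
theorem sum_indicator_le_sub_iInf {d : ℕ} (hρ : 0 ≤ ρ) (hw : 0 < w) (hM0 : 0 < M)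
    (hM : ρ * w ≤ M) (s : Fin d → ℤˣ) (x : Pt d) :
    ∑ i, {x : Pt d | 0 ≤ ((s i : ℤ) : ℝ) * x i}.indicator
        (fun _ => ρ ^ 2 * w ^ 4 / (Real.pi ^ 2 * M)) x ≤
      separable (fun i => sineBowl ρ M w (s i)) x -
        ⨅ z, separable (fun i => sineBowl ρ M w (s i)) z := by
  choose z _ hz using fun i => exists_minimizer_sineBowl hρ hw hM (s i)
  have hinf : ⨅ y, separable (fun i => sineBowl ρ M w (s i)) y ≤
      ∑ i, sineBowl ρ M w (s i) (z i) :=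
    ciInf_le (f := separable fun i => sineBowl ρ M w (s i))
      ⟨∑ i, sineBowl ρ M w (s i) (z i), by
        rintro _ ⟨y, rfl⟩
        exact Finset.sum_le_sum fun i _ => hz i _⟩ (WithLp.toLp 2 z)
  refine le_trans ?_ (sub_le_sub_left hinf _)
  rw [separable, ← Finset.sum_sub_distrib]
  refine Finset.sum_le_sum fun i _ => Set.indicator_apply_le' (fun hx => ?_) fun _ => ?_
  · obtain ⟨y, hy⟩ := sineBowl_apply_le hρ hw hM0 hM (s i)
    linarith [hz i y, sineBowl_nonneg hρ hw hM (s i) hx]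
  · exact sub_nonneg.2 (hz i _)

end SineBowl

/-! ### Assouad's argument over sign patterns -/

/-- The sign pattern `s` with the sign of the coordinate `i` reversed. -/
def flipSign {d : ℕ} (s : Fin d → ℤˣ) (i : Fin d) : Fin d → ℤˣ := s * Pi.mulSingle i (-1)

theorem flipSign_self {d : ℕ} (s : Fin d → ℤˣ) (i : Fin d) : flipSign s i i = -s i := by
  simp [flipSign]

theorem flipSign_of_ne {d : ℕ} (s : Fin d → ℤˣ) {i j : Fin d} (h : j ≠ i) :
    flipSign s i j = s j := by
  simp [flipSign, Pi.mulSingle_eq_of_ne h]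

theorem measurableSet_wrongSide {d : ℕ} (σ : ℤˣ) (i : Fin d) :
    MeasurableSet {x : Pt d | 0 ≤ ((σ : ℤ) : ℝ) * x i} :=
  measurableSet_le measurable_const (by fun_prop)

section Assouad

variable {d : ℕ} {ρ M w : ℝ}

theorem measurable_separable_sineBowl (s : Fin d → ℤˣ) :
    Measurable (separable fun i => sineBowl ρ M w (s i)) :=
  (continuous_iff_continuousAt.2 fun x => (hasFDerivAt_separable
    (fun i => hasDerivAt_sineBowl (s i)) x).continuousAt).measurable

theorem abs_separable_sineBowl_sub_flip_le (hρ : 0 ≤ ρ) (hw : 0 ≤ w) (s : Fin d → ℤˣ)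
    (i : Fin d) (x : Pt d) :
    |separable (fun j => sineBowl ρ M w (flipSign s i j)) x -
      separable (fun j => sineBowl ρ M w (s j)) x| ≤ 2 * (ρ * w ^ 3) := by
  rw [separable, separable, ← Finset.sum_sub_distrib, Finset.sum_eq_single i]
  · rw [abs_sub_comm]
    simpa [flipSign_self] using abs_sineBowl_sub_neg_le hρ hw (s i) (x i)
  · intro j _ hj
    simp [flipSign_of_ne s hj]
  · simp

theorem Algorithm.sum_pointLaw_le_simpleRegret (A : Algorithm d) (hρ : 0 ≤ ρ) (hw : 0 < w)
    (hM0 : 0 < M) (hM : ρ * w ≤ M) (s : Fin d → ℤˣ) (T : ℕ) :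
    ENNReal.ofReal (ρ ^ 2 * w ^ 4 / (Real.pi ^ 2 * M)) *
        ∑ i, A.pointLaw (separable fun i => sineBowl ρ M w (s i)) T
          {x | 0 ≤ ((s i : ℤ) : ℝ) * x i} ≤
      A.simpleRegret (separable fun i => sineBowl ρ M w (s i)) T := by
  set Δ := ρ ^ 2 * w ^ 4 / (Real.pi ^ 2 * M) with hΔ
  have hΔ0 : 0 ≤ Δ := by positivity
  set P := A.pointLaw (separable fun i => sineBowl ρ M w (s i)) T
  calc ENNReal.ofReal Δ * ∑ i, P {x | 0 ≤ ((s i : ℤ) : ℝ) * x i}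
      = ∫⁻ x, ∑ i, {x : Pt d | 0 ≤ ((s i : ℤ) : ℝ) * x i}.indicator
          (fun _ => ENNReal.ofReal Δ) x ∂P := by
        rw [lintegral_finsetSum _ fun i _ =>
          measurable_const.indicator (measurableSet_wrongSide (s i) i), Finset.mul_sum]
        exact Finset.sum_congr rfl fun i _ =>
          (lintegral_indicator_const (measurableSet_wrongSide (s i) i) _).symm
    _ ≤ _ := by
        refine lintegral_mono fun x => ?_
        refine le_trans (le_of_eq ?_)
          (ENNReal.ofReal_le_ofReal (sum_indicator_le_sub_iInf hρ hw hM0 hM s x))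
        rw [ENNReal.ofReal_sum_of_nonneg fun i _ => Set.indicator_nonneg (fun _ _ => hΔ0) x]
        refine Finset.sum_congr rfl fun i _ => ?_
        by_cases hx : x ∈ {x : Pt d | 0 ≤ ((s i : ℤ) : ℝ) * x i}
        · rw [Set.indicator_of_mem hx, Set.indicator_of_mem hx]
        · rw [Set.indicator_of_notMem hx, Set.indicator_of_notMem hx, ENNReal.ofReal_zero]

theorem Algorithm.le_pointLaw_add_pointLaw_flip (A : Algorithm d) (hρ : 0 ≤ ρ) (hw : 0 < w)
    {T : ℕ} (hT : T * (2 * (ρ * w ^ 3)) ^ 2 ≤ 1) (s : Fin d → ℤˣ) (i : Fin d) :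
    ENNReal.ofReal (1 / (4 * Real.exp 1)) ≤
      A.pointLaw (separable fun j => sineBowl ρ M w (s j)) T {x | 0 ≤ ((s i : ℤ) : ℝ) * x i} +
      A.pointLaw (separable fun j => sineBowl ρ M w (flipSign s i j)) T
        {x | 0 ≤ ((flipSign s i i) : ℤ) * x i} := by
  refine (A.le_pointLaw_add_pointLaw_compl
    (measurable_separable_sineBowl (M := M) (flipSign s i))
    (measurable_separable_sineBowl s)
    (abs_separable_sineBowl_sub_flip_le hρ hw.le s i) hT (measurableSet_wrongSide (s i) i)).trans ?_
  -- The wrong sides are closed half-spaces, so the complement of one lies in the other.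
  gcongr
  intro x hx
  simp only [Set.mem_compl_iff, Set.mem_ofPred_eq, not_le] at hx
  simpa [flipSign_self] using hx.le

/-- Assouad's lower bound over the hypercube of sign patterns. -/
theorem le_minimaxRegret {R : ℝ} (hρ : 0 ≤ ρ) (hw : 0 < w) (hM : ρ * w < M)
    (hR : √d * w ≤ R) {T : ℕ} (hT : T * (2 * (ρ * w ^ 3)) ^ 2 ≤ 1) :
    ENNReal.ofReal (d * (ρ ^ 2 * w ^ 4 / (Real.pi ^ 2 * M)) / (8 * Real.exp 1)) ≤
      minimaxRegret d ρ M R T := by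
  have hM0 : 0 < M := lt_of_le_of_lt (by positivity) hM
  refine le_iInf fun A => ?_
  set U := ⨆ f : {f : Pt d → ℝ // InClass ρ M R f}, A.simpleRegret f.1 T
  set Δ := ρ ^ 2 * w ^ 4 / (Real.pi ^ 2 * M) with hΔ
  have hΔ0 : 0 ≤ Δ := by positivity
  set c := ENNReal.ofReal (1 / (4 * Real.exp 1)) with hc
  let e (i : Fin d) (s : Fin d → ℤˣ) : ℝ≥0∞ :=
    A.pointLaw (separable fun j => sineBowl ρ M w (s j)) T {x | 0 ≤ ((s i : ℤ) : ℝ) * x i}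
  set N : ℝ≥0∞ := (Fintype.card (Fin d → ℤˣ) : ℝ≥0∞) with hN
  have hU (s : Fin d → ℤˣ) : ENNReal.ofReal Δ * ∑ i, e i s ≤ U :=
    (A.sum_pointLaw_le_simpleRegret hρ hw hM0 hM.le s T).trans
      (le_iSup (fun f : {f : Pt d → ℝ // InClass ρ M R f} => A.simpleRegret f.1 T)
        ⟨_, inClass_separable_sineBowl hρ hw hM hR s⟩)
  -- Each pattern is paired with its flip. Flipping permutes the patterns, so both halves of the sum
  -- agree; this 2 turns `4e` into `8e`.
  have hflip (i : Fin d) : N * c ≤ 2 * ∑ s, e i s := by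
    calc N * c = ∑ _s : Fin d → ℤˣ, c := by simp [hN]
      _ ≤ ∑ s, (e i s + e i (flipSign s i)) :=
        Finset.sum_le_sum fun s _ => A.le_pointLaw_add_pointLaw_flip hρ hw hT s i
      _ = 2 * ∑ s, e i s := by
        rw [Finset.sum_add_distrib, two_mul]
        congr 1
        exact Equiv.sum_comp (Equiv.mulRight (Pi.mulSingle i (-1))) (e i)
  have hsum : N * (d * ENNReal.ofReal Δ * c) ≤ N * (2 * U) := by
    calc N * (d * ENNReal.ofReal Δ * c) = ENNReal.ofReal Δ * ∑ _i : Fin d, N * c := by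
          simp only [Finset.sum_const, Finset.card_univ, Fintype.card_fin, nsmul_eq_mul]
          ring
      _ ≤ ENNReal.ofReal Δ * ∑ i, 2 * ∑ s, e i s := by
          exact mul_le_mul_right (Finset.sum_le_sum fun i _ => hflip i) _
      _ = 2 * ∑ s, ENNReal.ofReal Δ * ∑ i, e i s := by
          rw [← Finset.mul_sum, ← Finset.mul_sum, Finset.sum_comm]
          ring
      _ ≤ 2 * ∑ _s : Fin d → ℤˣ, U := by
          gcongr with s
          exact hU s
      _ = N * (2 * U) := by
          simp only [Finset.sum_const, Finset.card_univ, nsmul_eq_mul, ← hN]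
          ring
  have h2 : (d * ENNReal.ofReal Δ * c) ≤ 2 * U :=
    (ENNReal.mul_le_mul_iff_right (by simp [hN]) (by simp [hN])).1 hsum
  refine (ENNReal.mul_le_mul_iff_right two_ne_zero ENNReal.ofNat_ne_top).1
    (le_trans (le_of_eq ?_) h2)
  rw [hc, ← ENNReal.ofReal_natCast d, ← ENNReal.ofReal_mul (by positivity),
    ← ENNReal.ofReal_mul (by positivity), ← ENNReal.ofReal_ofNat 2,
    ← ENNReal.ofReal_mul (by positivity)]
  congr 1
  field_simp
  ring

end Assouad

end ZerothOrder

/-! ### Choice of the width and the limit -/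

theorem theorem2 :
    ∃ C : ℝ, 0 < C ∧ ∀ (d : ℕ) (ρ M R : ℝ), 0 < ρ → 0 < M → 0 < R →
      ENNReal.ofReal (C * (ρ ^ (2 / 3 : ℝ) / M * (d : ℝ))) ≤
        liminf (fun T : ℕ => ZerothOrder.minimaxRegret d ρ M R T * (T : ENNReal) ^ (2 / 3 : ℝ))
          atTop := by
  refine ⟨2 ^ (-(4 / 3) : ℝ) / (8 * Real.exp 1 * Real.pi ^ 2), by positivity,
    fun d ρ M R hρ hM hR => ?_⟩
  -- This width solves `T (2 ρ w³)² = 1`. It tends to 0, so the constraints involving `M` and `R`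
  -- hold for all large `T`.
  have hlim : Tendsto (fun T : ℕ => (2 * ρ) ^ (-(1 / 3) : ℝ) * (T : ℝ) ^ (-(1 / 6) : ℝ)) atTop
      (nhds 0) := by
    simpa using ((tendsto_rpow_neg_atTop (by norm_num : (0 : ℝ) < 1 / 6)).comp
      tendsto_natCast_atTop_atTop).const_mul ((2 * ρ) ^ (-(1 / 3) : ℝ))
  have hM' : ∀ᶠ T : ℕ in atTop,
      ρ * ((2 * ρ) ^ (-(1 / 3) : ℝ) * (T : ℝ) ^ (-(1 / 6) : ℝ)) < M :=
    (hlim.const_mul ρ).eventually_lt_const (by simpa using hM)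
  have hR' : ∀ᶠ T : ℕ in atTop,
      √d * ((2 * ρ) ^ (-(1 / 3) : ℝ) * (T : ℝ) ^ (-(1 / 6) : ℝ)) < R :=
    (hlim.const_mul √d).eventually_lt_const (by simpa using hR)
  refine le_liminf_of_le (by isBoundedDefault) ?_
  filter_upwards [hM', hR', eventually_gt_atTop 0] with T hTM hTR hT
  have hT0 : (0 : ℝ) < T := Nat.cast_pos.2 hT
  set w := (2 * ρ) ^ (-(1 / 3) : ℝ) * (T : ℝ) ^ (-(1 / 6) : ℝ) with hw
  have hw0 : 0 < w := by positivity
  have hpow (n : ℕ) : w ^ n = (2 * ρ) ^ (-(n / 3) : ℝ) * (T : ℝ) ^ (-(n / 6) : ℝ) := by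
    rw [hw, mul_pow, ← Real.rpow_natCast, ← Real.rpow_natCast, ← Real.rpow_mul (by positivity),
      ← Real.rpow_mul hT0.le]
    congr 2 <;> ring
  have h3 : T * (2 * (ρ * w ^ 3)) ^ 2 = 1 := by
    have h6 : w ^ 6 = ((2 * ρ) ^ 2)⁻¹ * (T : ℝ)⁻¹ := by
      rw [hpow, ← Real.rpow_natCast (2 * ρ) 2, ← Real.rpow_neg (by positivity), ← Real.rpow_neg_one]
      norm_num
    calc T * (2 * (ρ * w ^ 3)) ^ 2 = T * (2 * ρ) ^ 2 * w ^ 6 := by ring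
      _ = 1 := by
        rw [h6]
        field_simp
  have h4 : ρ ^ 2 * w ^ 4 * (T : ℝ) ^ (2 / 3 : ℝ) = 2 ^ (-(4 / 3) : ℝ) * ρ ^ (2 / 3 : ℝ) := by
    have hρ2 : ρ ^ (2 / 3 : ℝ) = ρ ^ 2 * ρ ^ (-(4 / 3) : ℝ) := by
      rw [← Real.rpow_natCast, ← Real.rpow_add hρ]
      norm_num
    have hTT : (T : ℝ) ^ (-(4 / 6) : ℝ) * (T : ℝ) ^ (2 / 3 : ℝ) = 1 := by
      rw [← Real.rpow_add hT0]
      norm_num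
    rw [hpow, Real.mul_rpow two_pos.le hρ.le, hρ2]
    push_cast
    linear_combination ρ ^ 2 * 2 ^ (-(4 / 3) : ℝ) * ρ ^ (-(4 / 3) : ℝ) * hTT
  refine le_trans (le_of_eq ?_) (mul_le_mul_left
    (ZerothOrder.le_minimaxRegret hρ.le hw0 hTM hTR.le h3.le) _)
  rw [← ENNReal.ofReal_natCast T, ENNReal.ofReal_rpow_of_pos hT0,
    ← ENNReal.ofReal_mul (by positivity)]
  congr 1
  calc _ = 2 ^ (-(4 / 3) : ℝ) * ρ ^ (2 / 3 : ℝ) * d / (8 * Real.exp 1 * Real.pi ^ 2 * M) := by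
        field_simp
    _ = _ := by
        rw [← h4]
        field_simp
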